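/- A bipartite graph $G$ has an explicit bipartition: finite non-empty vertex sets $V_1(G),V_2(G)$ and edge set $E(G)\subseteq V_1(G)\times V_2(G)$; put $v_j(G)=|V_j(G)|$. Let $\mathcal B^L_{k_1k_2}$ be the set of labelled bipartite graphs on $[k_1],[k_2]$, let $\mathcal B^L=\bigcup_{k_1,k_2\ge1}\mathcal B^L_{k_1k_2}$, and let $\mathcal B$ be the countable set of unlabelled bipartite graphs, i.e. labelled ones modulo isomorphisms that preserve each part. For $F$ with $v_j(F)=k_j$, let $t(F,G)$ be the proportion of pairs of maps $V_1(F)\to V_1(G)$, $V_2(F)\to V_2(G)$ that map edges to edges, and let $t_{\mathrm{ind}}(F,G)$ be the proportion of pairs of injective such maps that map edges to edges and non-edges to non-edges ($:=0$ if $v_1(F)>v_1(G)$ or $v_2(F)>v_2(G)$). Let $\tau(G)=(t(F,G))_{F\in\mathcal B}\in[0,1]^{\mathcal B}$ and $\tau^+(G)=(\tau(G),v_1(G)^{-1},v_2(G)^{-1})\in[0,1]^{\mathcal B}\times[0,1]^2$, with product topologies. Let $\overline{\mathcal B^*}=\overline{\tau(\mathcal B)}$ and $\overline{\mathcal B}=\overline{\tau^+(\mathcal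 B)}$, where $\mathcal B$ is identified with $\tau^+(\mathcal B)$, and let $\mathcal B_{\infty\infty}$ be the set of elements of $\overline{\mathcal B}$ whose last two coordinates are both $0$. The functions $t(F,\cdot)$ and $t_{\mathrm{ind}}(F,\cdot)$ are extended to $\mathcal B_{\infty\infty}$ by continuity (limits along finite graphs $G\to\Gamma$ in $\overline{\mathcal B}$, which exist). The projection $\pi:\overline{\mathcal B}\to\overline{\mathcal B^*}$ that forgets the last two coordinates restricts to a homeomorphism $\mathcal B_{\infty\infty}\cong\overline{\mathcal B^*}$, through which $t(F,\cdot)$ and $t_{\mathrm{ind}}(F,\cdot)$ are also defined on $\overline{\mathcal B^*}$. Let $\mathcal B^L_{\infty\infty}\cong\{0,1\}^{\mathbb N\times\mathbb N}$ be the space of labelled infinite bipartite graphs with both vertex sets equal to $\mathbb N$, with the product topology. A random $H\in\mathcal B^L_{\infty\infty}$ is exchangeable if its distribution is invariant under every pair of finite permutations of $V_1(H)$ and $V_2(H)$. Let $H|_{[n_1]\times[n_2]}\in\mathcal B^L_{n_1n_2}$ denote the induced subgraph on $[n_1],[n_2]$. **Theorem 8.5.** There is a one-to-one correspondence between distributions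 of random elements $\Gamma\in\mathcal B_{\infty\infty}$ (or, via $\pi$, $\Gamma\in\overline{\mathcal B^*}$) and distributions of exchangeable random infinite bipartite graphs $H\in\mathcal B^L_{\infty\infty}$, given by $$\mathbb E\,t_{\mathrm{ind}}(F,\Gamma)=\mathbb P\bigl(H|_{[k_1]\times[k_2]}=F\bigr)\qquad\text{for every }k_1,k_2\ge1\text{ and every }F\in\mathcal B^L_{k_1k_2},$$ or, equivalently, $$\mathbb E\,t(F,\Gamma)=\mathbb P(H\supset F)\qquad\text{for every }F\in\mathcal B^L,$$ where $H\supset F$ means $E(H)\supseteq E(F)$. Furthermore, if $\Gamma\in\mathcal B_{\infty\infty}$ and $H$ correspond to each other, then, as $n_1,n_2\to\infty$, $H|_{[n_1]\times[n_2]}$, regarded as a random element of $\mathcal B\subseteq\overline{\mathcal B}$, converges in distribution to $\Gamma$ in $\overline{\mathcal B}$. -/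

import Mathlib

open MeasureTheory Filter Topology

noncomputable section

namespace BipLimit

/-- A labelled bipartite graph with the explicit vertex parts `V₁`, `V₂`, given by the indicator of
its edge set `E ⊆ V₁ × V₂`. -/
abbrev Lab (V₁ V₂ : Type) : Type := V₁ → V₂ → Bool

/-- Isomorphism of bipartite graphs on `[n₁]`, `[n₂]`: relabel each part separately. -/
def isoSetoid (n₁ n₂ : ℕ) : Setoid (Lab (Fin n₁) (Fin n₂)) where
  r G G' := ∃ (σ : Equiv.Perm (Fin n₁)) (τ : Equiv.Perm (Fin n₂)),
    ∀ i j, G' i j = G (σ i) (τ j)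
  iseqv :=
    { refl := fun _ => ⟨1, 1, fun _ _ => rfl⟩
      symm := by
        rintro G G' ⟨σ, τ, h⟩
        exact ⟨σ⁻¹, τ⁻¹, fun i j => by simp [h]⟩
      trans := by
        rintro G G' G'' ⟨σ, τ, h⟩ ⟨σ', τ', h'⟩
        exact ⟨σ * σ', τ * τ', fun i j => by simp [h, h']⟩ }

/-- The countable set `𝓑` of unlabelled bipartite graphs, both parts finite and non-empty. -/
abbrev Unl : Type := Σ n : ℕ+ × ℕ+, Quotient (isoSetoid n.1 n.2)

/-- The number `v₁` of vertices in the first part. -/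
def v₁ (G : Unl) : ℕ := G.1.1

/-- The number `v₂` of vertices in the second part. -/
def v₂ (G : Unl) : ℕ := G.1.2

/-- The unlabelled graph underlying a labelled graph. -/
def unl {n₁ n₂ : ℕ+} (G : Lab (Fin n₁) (Fin n₂)) : Unl :=
  ⟨(n₁, n₂), Quotient.mk (isoSetoid n₁ n₂) G⟩

/-- `P(F ⊆ G[k₁,k₂])`: the proportion of pairs of maps of the vertex parts of `F` to those of `G`
that map edges to edges. -/
def tLab {k₁ k₂ n₁ n₂ : ℕ} (F : Lab (Fin k₁) (Fin k₂)) (G : Lab (Fin n₁) (Fin n₂)) : ℝ :=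
  (Nat.card {p : (Fin k₁ → Fin n₁) × (Fin k₂ → Fin n₂) //
      ∀ i j, F i j = true → G (p.1 i) (p.2 j) = true} : ℝ) /
    (Nat.card ((Fin k₁ → Fin n₁) × (Fin k₂ → Fin n₂)) : ℝ)

/-- `P(F = G[k₁,k₂]')`: the proportion of pairs of injective maps of the vertex parts of `F` to those
of `G` that map edges to edges and non-edges to non-edges. If there is no such pair of injective
maps, that is, if `k₁ > n₁` or `k₂ > n₂`, the value is `0 / 0 = 0`, as it should be. -/
def tIndLab {k₁ k₂ n₁ n₂ : ℕ} (F : Lab (Fin k₁) (Fin k₂)) (G : Lab (Fin n₁) (Fin n₂)) : ℝ :=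
  (Nat.card {p : (Fin k₁ ↪ Fin n₁) × (Fin k₂ ↪ Fin n₂) //
      ∀ i j, F i j = G (p.1 i) (p.2 j)} : ℝ) /
    (Nat.card ((Fin k₁ ↪ Fin n₁) × (Fin k₂ ↪ Fin n₂)) : ℝ)

theorem tLab_congr {k₁ k₂ n₁ n₂ : ℕ} {F F' : Lab (Fin k₁) (Fin k₂)} {G G' : Lab (Fin n₁) (Fin n₂)}
    (hF : (isoSetoid k₁ k₂).r F F') (hG : (isoSetoid n₁ n₂).r G G') :
    tLab F G = tLab F' G' := by
  obtain ⟨α, β, hF⟩ := hF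
  obtain ⟨σ, τ, hG⟩ := hG
  unfold tLab
  congr 2
  refine Nat.card_congr (Equiv.subtypeEquiv
    (Equiv.prodCongr (Equiv.arrowCongr α.symm σ.symm) (Equiv.arrowCongr β.symm τ.symm)) ?_)
  rintro ⟨f, g⟩
  simp only [Equiv.prodCongr_apply, Prod.map, Equiv.arrowCongr_apply, Function.comp, hF, hG,
    Equiv.apply_symm_apply, Equiv.symm_symm]
  constructor
  · intro h i j
    exact h (α i) (β j)
  · intro h i j
    simpa using h (α.symm i) (β.symm j)

theorem tIndLab_congr {k₁ k₂ n₁ n₂ : ℕ} {F F' : Lab (Fin k₁) (Fin k₂)}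
    {G G' : Lab (Fin n₁) (Fin n₂)}
    (hF : (isoSetoid k₁ k₂).r F F') (hG : (isoSetoid n₁ n₂).r G G') :
    tIndLab F G = tIndLab F' G' := by
  obtain ⟨α, β, hF⟩ := hF
  obtain ⟨σ, τ, hG⟩ := hG
  unfold tIndLab
  congr 2
  refine Nat.card_congr (Equiv.subtypeEquiv
    (Equiv.prodCongr (Equiv.embeddingCongr α.symm σ.symm)
      (Equiv.embeddingCongr β.symm τ.symm)) ?_)
  rintro ⟨f, g⟩
  have e1 : ∀ i, (Equiv.embeddingCongr α.symm σ.symm f) i = σ.symm (f (α i)) := fun _ => rfl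
  have e2 : ∀ j, (Equiv.embeddingCongr β.symm τ.symm g) j = τ.symm (g (β j)) := fun _ => rfl
  simp only [Equiv.prodCongr_apply, Prod.map, e1, e2, hF, hG, Equiv.apply_symm_apply]
  constructor
  · intro h i j
    exact h (α i) (β j)
  · intro h i j
    simpa using h (α.symm i) (β.symm j)

/-- `t(F,G)` for unlabelled bipartite graphs. -/
def t (F G : Unl) : ℝ :=
  Quotient.liftOn₂ F.2 G.2 (fun F' G' => tLab F' G') (fun _ _ _ _ hF hG => tLab_congr hF hG)

/-- `t_ind(F,G)` for unlabelled bipartite graphs. -/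
def tInd (F G : Unl) : ℝ :=
  Quotient.liftOn₂ F.2 G.2 (fun F' G' => tIndLab F' G')
    (fun _ _ _ _ hF hG => tIndLab_congr hF hG)

theorem t_mem (F G : Unl) : t F G ∈ unitInterval := by
  obtain ⟨k, F⟩ := F
  obtain ⟨n, G⟩ := G
  induction F using Quotient.ind
  induction G using Quotient.ind
  refine ⟨div_nonneg (Nat.cast_nonneg _) (Nat.cast_nonneg _),
    div_le_one_of_le₀ ?_ (Nat.cast_nonneg _)⟩
  exact_mod_cast Finite.card_subtype_le _

theorem inv_natCast_mem (n : ℕ) : ((n : ℝ)⁻¹) ∈ unitInterval :=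
  ⟨by positivity, Nat.cast_inv_le_one n⟩

/-- `τ(G) = (t(F,G))_F ∈ [0,1]^𝓑`. -/
def tau (G : Unl) : Unl → unitInterval := fun F => ⟨t F G, t_mem F G⟩

/-- `τ⁺(G) = (τ(G), 1/v₁(G), 1/v₂(G)) ∈ [0,1]^𝓑 × [0,1] × [0,1]`. -/
def tauPlus (G : Unl) : (Unl → unitInterval) × unitInterval × unitInterval :=
  (tau G, ⟨((v₁ G : ℝ))⁻¹, inv_natCast_mem _⟩, ⟨((v₂ G : ℝ))⁻¹, inv_natCast_mem _⟩)

/-- The closure of `𝓑* = τ(𝓑)`, a compact subset of `[0,1]^𝓑`. -/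
def BStarBar : Set (Unl → unitInterval) := closure (Set.range tau)

/-- The compactification of `𝓑`: the closure of `τ⁺(𝓑)`. -/
def BBar : Set ((Unl → unitInterval) × unitInterval × unitInterval) :=
  closure (Set.range tauPlus)

/-- A finite graph, as an element of the compactification. -/
def toBBar (G : Unl) : BBar := ⟨tauPlus G, subset_closure ⟨G, rfl⟩⟩

/-- The bipartite graph limits `𝓑_{∞,∞}`: both `1/v₁` and `1/v₂` vanish. -/
def BInf : Set BBar := {Γ | Γ.1.2.1 = 0 ∧ Γ.1.2.2 = 0}

/-- `t(F,·)` on the compactification: a coordinate, hence the continuous extension of `t(F,·)`. -/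
def tBar (F : Unl) (Γ : BBar) : ℝ := Γ.1.1 F

/-- `t_ind(F,·)` on the compactification, extended from `𝓑` by continuity: the limit of
`t_ind(F,G)` as the finite graph `G` tends to `Γ`. -/
def tIndBar (F : Unl) (Γ : BBar) : ℝ := limUnder (comap toBBar (𝓝 Γ)) (tInd F)

/-- `𝓛_{∞,∞}`: labelled bipartite graphs with both parts equal to `ℕ`, with the product topology
and its Borel σ-algebra. -/
abbrev LabInf : Type := Lab ℕ ℕ

/-- The induced subgraph `H|_{[k₁]×[k₂]}`. -/
def restr (k₁ k₂ : ℕ) (H : LabInf) : Lab (Fin k₁) (Fin k₂) := fun i j => H i j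

/-- `H ⊃ F`: every edge of the finite labelled graph `F` is an edge of `H`. -/
def Contains {k₁ k₂ : ℕ} (H : LabInf) (F : Lab (Fin k₁) (Fin k₂)) : Prop :=
  ∀ i j, F i j = true → H i j = true

/-- Relabelling of the two parts of an infinite graph. -/
def permute (σ τ : Equiv.Perm ℕ) (H : LabInf) : LabInf := fun i j => H (σ i) (τ j)

/-- The law `ν` of a random infinite bipartite graph is (separately) exchangeable: it is invariant
under every pair of finite permutations of the two parts. -/
def Exchangeable (ν : ProbabilityMeasure LabInf) : Prop :=
  ∀ σ τ : Equiv.Perm ℕ, {i | σ i ≠ i}.Finite → {j | τ j ≠ j}.Finite →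
    Measure.map (permute σ τ) (ν : Measure LabInf) = (ν : Measure LabInf)

/-- `H|_{[n₁]×[n₂]}` as an element of the compactification. -/
def sub (n : ℕ+ × ℕ+) (H : LabInf) : BBar := toBBar (unl (restr n.1 n.2 H))

theorem measurable_sub (n : ℕ+ × ℕ+) : Measurable (sub n) := by
  have h1 : Measurable (restr n.1 n.2) := by
    unfold restr
    fun_prop
  exact (measurable_of_countable
    (fun F : Lab (Fin n.1) (Fin n.2) => toBBar (unl F))).comp h1

end BipLimit

end

noncomputable section

namespace BipLimit


theorem exists_unl (F : Unl) : ∃ (k₁ k₂ : ℕ+) (F' : Lab (Fin k₁) (Fin k₂)), F = unl F' := by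
  obtain ⟨⟨k₁, k₂⟩, F⟩ := F
  induction F using Quotient.ind with
  | _ F' => exact ⟨k₁, k₂, F', rfl⟩

theorem continuous_restr (k₁ k₂ : ℕ) : Continuous (restr k₁ k₂) := by
  unfold restr; fun_prop

theorem isClopen_restr_preimage {k₁ k₂ : ℕ} (s : Set (Lab (Fin k₁) (Fin k₂))) :
    IsClopen (restr k₁ k₂ ⁻¹' s) :=
  (isClopen_discrete s).preimage (continuous_restr k₁ k₂)

theorem setOf_contains_eq {k₁ k₂ : ℕ} (F : Lab (Fin k₁) (Fin k₂)) :
    {H : LabInf | Contains H F} =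
      restr k₁ k₂ ⁻¹' {F' | ∀ i j, F i j = true → F' i j = true} := rfl

theorem isClopen_contains {k₁ k₂ : ℕ} (F : Lab (Fin k₁) (Fin k₂)) :
    IsClopen {H : LabInf | Contains H F} := by
  rw [setOf_contains_eq]; exact isClopen_restr_preimage _

theorem isClopen_restr_eq {k₁ k₂ : ℕ} (F : Lab (Fin k₁) (Fin k₂)) :
    IsClopen {H : LabInf | restr k₁ k₂ H = F} := isClopen_restr_preimage {F}

/-- The events that `H` contains a given finite graph. -/
def containsSets : Set (Set LabInf) :=
  {s | ∃ (k₁ k₂ : ℕ+) (F : Lab (Fin k₁) (Fin k₂)), s = {H | Contains H F}}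

/-- The finite graph `F` with isolated vertices added, or with vertices removed. -/
def resize {k₁ k₂ : ℕ} (F : Lab (Fin k₁) (Fin k₂)) (m₁ m₂ : ℕ) : Lab (Fin m₁) (Fin m₂) :=
  fun i j => if h : (i : ℕ) < k₁ ∧ (j : ℕ) < k₂ then F ⟨i, h.1⟩ ⟨j, h.2⟩ else false

theorem contains_resize {k₁ k₂ m₁ m₂ : ℕ} (h₁ : k₁ ≤ m₁) (h₂ : k₂ ≤ m₂)
    (F : Lab (Fin k₁) (Fin k₂)) (H : LabInf) :
    Contains H (resize F m₁ m₂) ↔ Contains H F := by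
  constructor
  · intro h i j hij
    exact h (Fin.castLE h₁ i) (Fin.castLE h₂ j) (by simpa [resize] using hij)
  · intro h i j hij
    unfold resize at hij
    split_ifs at hij with hlt
    exact h ⟨i, hlt.1⟩ ⟨j, hlt.2⟩ hij

theorem isPiSystem_containsSets : IsPiSystem containsSets := by
  rintro _ ⟨k₁, k₂, F, rfl⟩ _ ⟨l₁, l₂, F', rfl⟩ -
  refine ⟨max k₁ l₁, max k₂ l₂, fun i j =>
    resize F (max k₁ l₁ : ℕ+) (max k₂ l₂ : ℕ+) i j ||
      resize F' (max k₁ l₁ : ℕ+) (max k₂ l₂ : ℕ+) i j, ?_⟩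
  ext H
  have e₁ := contains_resize (m₁ := (max k₁ l₁ : ℕ+)) (m₂ := (max k₂ l₂ : ℕ+))
    (by exact_mod_cast le_max_left k₁ l₁) (by exact_mod_cast le_max_left k₂ l₂) F H
  have e₂ := contains_resize (m₁ := (max k₁ l₁ : ℕ+)) (m₂ := (max k₂ l₂ : ℕ+))
    (by exact_mod_cast le_max_right k₁ l₁) (by exact_mod_cast le_max_right k₂ l₂) F' H
  simp only [Set.mem_inter_iff, Set.mem_ofPred_eq, ← e₁, ← e₂]
  simp only [Contains, Bool.or_eq_true, or_imp, forall_and]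

theorem generateFrom_containsSets :
    (inferInstance : MeasurableSpace LabInf) = MeasurableSpace.generateFrom containsSets := by
  apply le_antisymm
  · have h : @Measurable LabInf LabInf (MeasurableSpace.generateFrom containsSets)
        inferInstance id := by
      refine (@measurable_pi_iff _ _ _ (MeasurableSpace.generateFrom containsSets) _ _).2 fun i =>
        (@measurable_pi_iff _ _ _ (MeasurableSpace.generateFrom containsSets) _ _).2 fun j => ?_
      refine @measurable_to_bool _ (MeasurableSpace.generateFrom containsSets) _ ?_
      apply MeasurableSpace.measurableSet_generateFrom
      refine ⟨i.succPNat, j.succPNat,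
        fun a b => decide ((a : ℕ) = i ∧ (b : ℕ) = j), ?_⟩
      ext H
      simp only [Set.mem_preimage, Set.mem_singleton_iff, id, Set.mem_ofPred_eq, Contains,
        decide_eq_true_eq]
      constructor
      · rintro h a b ⟨ha, hb⟩
        rwa [ha, hb]
      · intro h
        exact h ⟨i, by simp⟩ ⟨j, by simp⟩ ⟨rfl, rfl⟩
    exact fun s hs => h hs
  · apply MeasurableSpace.generateFrom_le
    rintro _ ⟨k₁, k₂, F, rfl⟩
    exact (isClopen_contains F).isOpen.measurableSet

theorem ext_of_contains {ν ν' : Measure LabInf} [IsProbabilityMeasure ν] [IsProbabilityMeasure ν']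
    (h : ∀ (k₁ k₂ : ℕ+) (F : Lab (Fin k₁) (Fin k₂)),
      ν.real {H | Contains H F} = ν'.real {H | Contains H F}) : ν = ν' := by
  refine ext_of_generate_finite containsSets generateFrom_containsSets isPiSystem_containsSets
    ?_ (by simp)
  rintro _ ⟨k₁, k₂, F, rfl⟩
  exact (measureReal_eq_measureReal_iff).1 (h k₁ k₂ F)

theorem measureReal_preimage_restr (ν : Measure LabInf) [IsFiniteMeasure ν] {k₁ k₂ : ℕ}
    (s : Set (Lab (Fin k₁) (Fin k₂))) [DecidablePred (· ∈ s)] :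
    ν.real (restr k₁ k₂ ⁻¹' s) =
      ∑ F' ∈ Finset.univ.filter (· ∈ s), ν.real {H | restr k₁ k₂ H = F'} := by
  rw [← measureReal_biUnion_finset]
  · congr 1
    ext H
    simp
  · intro F _ F' _ hne
    exact Set.disjoint_left.2 fun H h h' => hne (h.symm.trans h')
  · exact fun F _ => (isClopen_restr_eq F).isOpen.measurableSet

theorem ext_of_restr {ν ν' : Measure LabInf} [IsProbabilityMeasure ν] [IsProbabilityMeasure ν']
    (h : ∀ (k₁ k₂ : ℕ+) (F : Lab (Fin k₁) (Fin k₂)),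
      ν.real {H | restr k₁ k₂ H = F} = ν'.real {H | restr k₁ k₂ H = F}) : ν = ν' := by
  classical
  refine ext_of_contains fun k₁ k₂ F => ?_
  rw [setOf_contains_eq, measureReal_preimage_restr, measureReal_preimage_restr]
  exact Finset.sum_congr rfl fun F' _ => h k₁ k₂ F'

/-! ### Sampling vertices with replacement -/

/-- A sequence of independent uniform elements of `Fin n`. -/
def iidUniform (n : ℕ) (ι : Type) [NeZero n] : Measure (ι → Fin n) :=
  Measure.infinitePi fun _ => ProbabilityTheory.uniformOn Set.univ

instance (n : ℕ) [NeZero n] :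
    IsProbabilityMeasure (ProbabilityTheory.uniformOn (Set.univ : Set (Fin n))) :=
  ProbabilityTheory.isProbabilityMeasure_uniformOn Set.finite_univ Set.univ_nonempty

instance (n : ℕ) (ι : Type) [NeZero n] : IsProbabilityMeasure (iidUniform n ι) := by
  unfold iidUniform; infer_instance

theorem iidUniform_map_comp (n : ℕ) [NeZero n] {ι α : Type} {f : α → ι}
    (hf : Function.Injective f) :
    (iidUniform n ι).map (fun ω i => ω (f i)) = iidUniform n α :=
  Measure.map_infinitePi_infinitePi_of_inj hf

theorem iidUniform_real_singleton (n k : ℕ) [NeZero n] (p : Fin k → Fin n) :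
    (iidUniform n (Fin k)).real {p} = ((n : ℝ) ^ k)⁻¹ := by
  unfold iidUniform
  rw [measureReal_def, Measure.infinitePi_singleton_of_fintype]
  simp [ProbabilityTheory.uniformOn_univ, ENNReal.toReal_inv]

theorem iidUniform_prod_real {n₁ n₂ k₁ k₂ : ℕ} [NeZero n₁] [NeZero n₂]
    (P : (Fin k₁ → Fin n₁) × (Fin k₂ → Fin n₂) → Prop) :
    ((iidUniform n₁ (Fin k₁)).prod (iidUniform n₂ (Fin k₂))).real {p | P p} =
      (Nat.card {p // P p} : ℝ) /
        (Nat.card ((Fin k₁ → Fin n₁) × (Fin k₂ → Fin n₂)) : ℝ) := by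
  classical
  have e : {p | P p} = (Finset.univ.filter P : Set _) := by simp
  rw [e, ← sum_measureReal_singleton]
  have h : ∀ p : (Fin k₁ → Fin n₁) × (Fin k₂ → Fin n₂),
      ((iidUniform n₁ (Fin k₁)).prod (iidUniform n₂ (Fin k₂))).real {p} =
        ((n₁ : ℝ) ^ k₁)⁻¹ * ((n₂ : ℝ) ^ k₂)⁻¹ := by
    intro p
    rw [← Set.singleton_prod_singleton (a := p.1) (b := p.2), measureReal_prod_prod,
      iidUniform_real_singleton, iidUniform_real_singleton]
  simp [h, Nat.card_eq_fintype_card, Fintype.card_subtype, div_eq_mul_inv, mul_comm]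

/-- The infinite graph obtained from sequences of vertices of `G`. -/
def pullback {V₁ V₂ : Type} (G : Lab V₁ V₂) (p : (ℕ → V₁) × (ℕ → V₂)) : LabInf :=
  fun i j => G (p.1 i) (p.2 j)

theorem measurable_pullback {n₁ n₂ : ℕ} (G : Lab (Fin n₁) (Fin n₂)) :
    Measurable (pullback G) := by
  have h : Measurable fun q : Fin n₁ × Fin n₂ => G q.1 q.2 := measurable_of_countable _
  refine measurable_pi_iff.2 fun i => measurable_pi_iff.2 fun j => ?_
  have h' : Measurable fun p : (ℕ → Fin n₁) × (ℕ → Fin n₂) => (p.1 i, p.2 j) := by fun_prop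
  exact h.comp h'

/-- The law of the infinite graph obtained by sampling vertices of `G` with replacement. -/
def sampleMeasure {n₁ n₂ : ℕ} [NeZero n₁] [NeZero n₂] (G : Lab (Fin n₁) (Fin n₂)) :
    ProbabilityMeasure LabInf :=
  ⟨((iidUniform n₁ ℕ).prod (iidUniform n₂ ℕ)).map (pullback G),
    Measure.isProbabilityMeasure_map (measurable_pullback G).aemeasurable⟩

theorem measurable_permute (σ τ : Equiv.Perm ℕ) : Measurable (permute σ τ) := by
  unfold permute; fun_prop

theorem continuous_permute (σ τ : Equiv.Perm ℕ) : Continuous (permute σ τ) := by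
  unfold permute; fun_prop

theorem iidUniform_prod_map_comp {n₁ n₂ : ℕ} [NeZero n₁] [NeZero n₂] {α β : Type} {f : α → ℕ}
    {g : β → ℕ} (hf : Function.Injective f) (hg : Function.Injective g) :
    ((iidUniform n₁ ℕ).prod (iidUniform n₂ ℕ)).map
        (Prod.map (fun ω i => ω (f i)) (fun ω j => ω (g j))) =
      (iidUniform n₁ α).prod (iidUniform n₂ β) := by
  rw [← Measure.map_prod_map _ _ (by fun_prop) (by fun_prop), iidUniform_map_comp _ hf,
    iidUniform_map_comp _ hg]

theorem exchangeable_sampleMeasure {n₁ n₂ : ℕ} [NeZero n₁] [NeZero n₂]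
    (G : Lab (Fin n₁) (Fin n₂)) : Exchangeable (sampleMeasure G) := by
  intro σ τ _ _
  change Measure.map _ (Measure.map _ _) = Measure.map _ _
  conv_rhs => rw [← iidUniform_prod_map_comp σ.injective τ.injective]
  rw [Measure.map_map (measurable_permute σ τ) (measurable_pullback G),
    Measure.map_map (measurable_pullback G) (by fun_prop)]
  rfl

theorem sampleMeasure_preimage_restr {n₁ n₂ k₁ k₂ : ℕ} [NeZero n₁] [NeZero n₂]
    (G : Lab (Fin n₁) (Fin n₂)) (s : Set (Lab (Fin k₁) (Fin k₂))) :
    (sampleMeasure G : Measure LabInf).real (restr k₁ k₂ ⁻¹' s) =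
      (Nat.card {p : (Fin k₁ → Fin n₁) × (Fin k₂ → Fin n₂) //
        (fun i j => G (p.1 i) (p.2 j)) ∈ s} : ℝ) /
        (Nat.card ((Fin k₁ → Fin n₁) × (Fin k₂ → Fin n₂)) : ℝ) := by
  rw [← iidUniform_prod_real, ← iidUniform_prod_map_comp (n₁ := n₁) (n₂ := n₂)
    (Fin.val_injective (n := k₁)) (Fin.val_injective (n := k₂))]
  change (Measure.map _ _).real _ = _
  rw [map_measureReal_apply (measurable_pullback G) (isClopen_restr_preimage s).isOpen.measurableSet,
    map_measureReal_apply (by fun_prop) (Set.toFinite _).measurableSet]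
  rfl

theorem sampleMeasure_contains {n₁ n₂ k₁ k₂ : ℕ} [NeZero n₁] [NeZero n₂]
    (G : Lab (Fin n₁) (Fin n₂)) (F : Lab (Fin k₁) (Fin k₂)) :
    (sampleMeasure G : Measure LabInf).real {H | Contains H F} = tLab F G :=
  sampleMeasure_preimage_restr G {F' | ∀ i j, F i j = true → F' i j = true}


theorem continuous_measureReal_of_isClopen {Ω : Type*} [TopologicalSpace Ω] [MeasurableSpace Ω]
    [BorelSpace Ω] [HasOuterApproxClosed Ω] {s : Set Ω} (hs : IsClopen s) :
    Continuous fun ν : ProbabilityMeasure Ω => (ν : Measure Ω).real s := by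
  have h : Continuous fun ν : ProbabilityMeasure Ω => (ν s : ℝ) :=
    NNReal.continuous_coe.comp (continuous_iff_continuousAt.2 fun ν =>
      ProbabilityMeasure.tendsto_measure_of_isClopen_of_tendsto tendsto_id hs)
  exact h

theorem tendsto_of_tendsto_contains {ι : Type*} {L : Filter ι} {ν : ι → ProbabilityMeasure LabInf}
    {ν₀ : ProbabilityMeasure LabInf}
    (h : ∀ (k₁ k₂ : ℕ+) (F : Lab (Fin k₁) (Fin k₂)),
      Tendsto (fun i => (ν i : Measure LabInf).real {H | Contains H F}) L
        (𝓝 ((ν₀ : Measure LabInf).real {H | Contains H F}))) :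
    Tendsto ν L (𝓝 ν₀) := by
  refine tendsto_nhds_of_unique_mapClusterPt fun θ hθ => ?_
  obtain ⟨U, hU, hθ⟩ := mapClusterPt_iff_ultrafilter.1 hθ
  apply Subtype.ext
  refine ext_of_contains (ν := (θ : Measure LabInf)) (ν' := (ν₀ : Measure LabInf))
    fun k₁ k₂ F => ?_
  exact tendsto_nhds_unique
    (((continuous_measureReal_of_isClopen (isClopen_contains F)).tendsto θ).comp hθ)
    ((h k₁ k₂ F).mono_left hU)

theorem isClosed_exchangeable : IsClosed {ν : ProbabilityMeasure LabInf | Exchangeable ν} := by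
  have e : {ν : ProbabilityMeasure LabInf | Exchangeable ν} =
      ⋂ (σ : Equiv.Perm ℕ) (τ : Equiv.Perm ℕ) (_ : {i | σ i ≠ i}.Finite)
        (_ : {j | τ j ≠ j}.Finite),
        {ν | ν.map (measurable_permute σ τ).aemeasurable = ν} := by
    ext ν
    simp only [Exchangeable, Set.mem_ofPred_eq, Set.mem_iInter]
    refine forall₂_congr fun σ τ => forall₂_congr fun _ _ => ?_
    rw [← ProbabilityMeasure.toMeasure_injective.eq_iff, ProbabilityMeasure.toMeasure_map]
  rw [e]
  refine isClosed_iInter fun σ => isClosed_iInter fun τ => isClosed_iInter fun _ =>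
    isClosed_iInter fun _ => isClosed_eq ?_ continuous_id
  exact ProbabilityMeasure.continuous_map (continuous_permute σ τ)

/-- `ν` is the law of an exchangeable random graph with subgraph probabilities `x`. -/
def Represents (ν : ProbabilityMeasure LabInf) (x : Unl → unitInterval) : Prop :=
  Exchangeable ν ∧ ∀ (k₁ k₂ : ℕ+) (F : Lab (Fin k₁) (Fin k₂)),
    (ν : Measure LabInf).real {H | Contains H F} = x (unl F)

theorem isClosed_represents :
    IsClosed {p : ProbabilityMeasure LabInf × (Unl → unitInterval) | Represents p.1 p.2} := by
  have e : {p : ProbabilityMeasure LabInf × (Unl → unitInterval) | Represents p.1 p.2} =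
      (Prod.fst ⁻¹' {ν | Exchangeable ν}) ∩
        ⋂ (k₁ : ℕ+) (k₂ : ℕ+) (F : Lab (Fin k₁) (Fin k₂)),
          {p : ProbabilityMeasure LabInf × (Unl → unitInterval) |
            (p.1 : Measure LabInf).real {H | Contains H F} = (p.2 (unl F) : ℝ)} := by
    ext p
    simp [Represents]
  rw [e]
  refine (isClosed_exchangeable.preimage continuous_fst).inter <| isClosed_iInter fun k₁ =>
    isClosed_iInter fun k₂ => isClosed_iInter fun F => isClosed_eq ?_ (by fun_prop)
  exact (continuous_measureReal_of_isClopen (isClopen_contains F)).comp continuous_fst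

theorem represents_sampleMeasure {n₁ n₂ : ℕ+} (G : Lab (Fin n₁) (Fin n₂)) :
    Represents (sampleMeasure G) (tau (unl G)) :=
  ⟨exchangeable_sampleMeasure G, fun _ _ F => sampleMeasure_contains G F⟩

theorem exists_represents (x : BStarBar) : ∃ ν, Represents ν x := by
  have h : IsClosed (Prod.snd ''
      {p : ProbabilityMeasure LabInf × (Unl → unitInterval) | Represents p.1 p.2}) :=
    isClosedMap_snd_of_compactSpace _ isClosed_represents
  have h' : BStarBar ⊆ Prod.snd ''
      {p : ProbabilityMeasure LabInf × (Unl → unitInterval) | Represents p.1 p.2} := by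
    refine closure_minimal ?_ h
    rintro _ ⟨G, rfl⟩
    obtain ⟨n₁, n₂, G, rfl⟩ := exists_unl G
    exact ⟨(sampleMeasure G, _), represents_sampleMeasure G, rfl⟩
  obtain ⟨p, hp, e⟩ := h' x.2
  exact ⟨p.1, e ▸ hp⟩

/-- The exchangeable law with subgraph probabilities `x`. -/
def limitLaw (x : BStarBar) : ProbabilityMeasure LabInf := (exists_represents x).choose

theorem represents_limitLaw (x : BStarBar) : Represents (limitLaw x) x :=
  (exists_represents x).choose_spec

theorem limitLaw_contains (x : BStarBar) {k₁ k₂ : ℕ+} (F : Lab (Fin k₁) (Fin k₂)) :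
    (limitLaw x : Measure LabInf).real {H | Contains H F} = x.1 (unl F) :=
  (represents_limitLaw x).2 k₁ k₂ F

theorem continuous_limitLaw : Continuous limitLaw := by
  refine continuous_iff_continuousAt.2 fun x => tendsto_of_tendsto_contains fun k₁ k₂ F => ?_
  simp only [limitLaw_contains]
  have h : Continuous fun y : BStarBar => ((y.1 (unl F) : unitInterval) : ℝ) :=
    continuous_subtype_val.comp ((continuous_apply (unl F)).comp continuous_subtype_val)
  exact h.tendsto x

theorem limitLaw_tau {n₁ n₂ : ℕ+} (G : Lab (Fin n₁) (Fin n₂)) :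
    limitLaw ⟨tau (unl G), subset_closure ⟨_, rfl⟩⟩ = sampleMeasure G := by
  apply Subtype.ext
  refine ext_of_contains (ν := (limitLaw _ : Measure LabInf))
    (ν' := (sampleMeasure G : Measure LabInf)) fun k₁ k₂ F => ?_
  rw [limitLaw_contains, sampleMeasure_contains]
  rfl

theorem measurable_limitLaw : Measurable fun x => (limitLaw x : Measure LabInf) := by
  refine Measurable.measure_of_isPiSystem_of_isProbabilityMeasure generateFrom_containsSets
    isPiSystem_containsSets ?_
  rintro _ ⟨k₁, k₂, F, rfl⟩
  have h : Continuous fun x => (limitLaw x : Measure LabInf).real {H | Contains H F} :=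
    (continuous_measureReal_of_isClopen (isClopen_contains F)).comp continuous_limitLaw
  simpa [measureReal_def] using h.measurable.ennreal_ofReal

/-- The mixture of the laws `limitLaw x`. -/
def mixture (μ : ProbabilityMeasure BStarBar) : ProbabilityMeasure LabInf :=
  ⟨(μ : Measure BStarBar).bind fun x => (limitLaw x : Measure LabInf),
    isProbabilityMeasure_bind measurable_limitLaw.aemeasurable
      (ae_of_all _ fun x => (limitLaw x).2)⟩

theorem mixture_real (μ : ProbabilityMeasure BStarBar) {s : Set LabInf} (hs : MeasurableSet s) :
    (mixture μ : Measure LabInf).real s =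
      ∫ x, (limitLaw x : Measure LabInf).real s ∂(μ : Measure BStarBar) := by
  have h := Measure.bind_apply (m := (μ : Measure BStarBar)) hs measurable_limitLaw.aemeasurable
  change ((μ : Measure BStarBar).bind _ s).toReal = _
  rw [h, ← integral_toReal]
  · rfl
  · exact ((Measure.measurable_coe hs).comp measurable_limitLaw).aemeasurable
  · exact ae_of_all _ fun x => measure_lt_top _ _

theorem mixture_contains (μ : ProbabilityMeasure BStarBar) {k₁ k₂ : ℕ+}
    (F : Lab (Fin k₁) (Fin k₂)) :
    (mixture μ : Measure LabInf).real {H | Contains H F} =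
      ∫ x, ((x : Unl → unitInterval) (unl F) : ℝ) ∂(μ : Measure BStarBar) := by
  simp only [mixture_real μ (isClopen_contains F).isOpen.measurableSet, limitLaw_contains]

theorem exchangeable_mixture (μ : ProbabilityMeasure BStarBar) : Exchangeable (mixture μ) := by
  intro σ τ hσ hτ
  ext s hs
  rw [Measure.map_apply (measurable_permute σ τ) hs]
  change ((μ : Measure BStarBar).bind _) _ = ((μ : Measure BStarBar).bind _) _
  rw [Measure.bind_apply hs measurable_limitLaw.aemeasurable,
    Measure.bind_apply (measurable_permute σ τ hs) measurable_limitLaw.aemeasurable]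
  refine lintegral_congr fun x => ?_
  rw [← Measure.map_apply (measurable_permute σ τ) hs, (represents_limitLaw x).1 σ τ hσ hτ]


/-! ### Sampling with and without replacement -/

/-- The probability that a uniform map `[k] → [n]` is injective. -/
def injProb (k n : ℕ) : ℝ := (Nat.card (Fin k ↪ Fin n) : ℝ) / Nat.card (Fin k → Fin n)

theorem tendsto_injProb (k : ℕ) : Tendsto (injProb k) atTop (𝓝 1) := by
  have e : ∀ k n, injProb k n = (n.descFactorial k : ℝ) / (n : ℝ) ^ k := by
    intro k n
    simp [injProb, Nat.card_eq_fintype_card, Fintype.card_embedding_eq]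
  induction k with
  | zero => simp [funext (e 0)]
  | succ k ih =>
    have h : Tendsto (fun n : ℕ => ((n : ℝ) - k) / n) atTop (𝓝 1) := by
      have h₁ : Tendsto (fun n : ℕ => 1 - (k : ℝ) / n) atTop (𝓝 (1 - 0)) :=
        tendsto_const_nhds.sub (tendsto_const_div_atTop_nhds_zero_nat _)
      rw [sub_zero] at h₁
      refine h₁.congr' ?_
      filter_upwards [eventually_gt_atTop 0] with n hn
      have : (n : ℝ) ≠ 0 := by positivity
      field_simp
    have h' := h.mul ih
    rw [one_mul] at h'
    refine h'.congr' ?_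
    filter_upwards [eventually_ge_atTop k] with n hn
    rw [e, e, Nat.descFactorial_succ, Nat.cast_mul, Nat.cast_sub hn, pow_succ, div_mul_div_comm,
      mul_comm ((n : ℝ) ^ k)]

theorem abs_average_sub_average_le {Ω I : Type*} [Fintype Ω] [Nonempty Ω] [Fintype I] (e : I ↪ Ω)
    {f : Ω → ℝ} (h₀ : ∀ x, 0 ≤ f x) (h₁ : ∀ x, f x ≤ 1) :
    |(∑ x, f x) / Fintype.card Ω - (∑ i, f (e i)) / Fintype.card I| ≤
      1 - (Fintype.card I : ℝ) / Fintype.card Ω := by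
  classical
  set N : ℝ := (Fintype.card Ω : ℝ)
  set m : ℝ := (Fintype.card I : ℝ)
  set S := ∑ i, f (e i)
  have hN : 0 < N := by positivity
  have hm : 0 ≤ m := by positivity
  have hmN : m ≤ N := Nat.cast_le.2 (Fintype.card_le_of_embedding e)
  have hS₀ : 0 ≤ S := Finset.sum_nonneg fun i _ => h₀ _
  have hS₁ : S ≤ m := (Finset.sum_le_sum fun i _ => h₁ (e i)).trans (by simp [m])
  have hS : S = ∑ x ∈ Finset.univ.map e, f x := by simp [S]
  have hT : ∑ x, f x = S + ∑ x ∈ (Finset.univ.map e)ᶜ, f x := by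
    rw [hS, Finset.sum_add_sum_compl]
  set R := ∑ x ∈ (Finset.univ.map e)ᶜ, f x
  have hR₀ : 0 ≤ R := Finset.sum_nonneg fun i _ => h₀ _
  have hR₁ : R ≤ N - m := by
    refine (Finset.sum_le_sum fun i _ => h₁ i).trans ?_
    rw [Finset.sum_const, nsmul_one, Finset.card_compl, Finset.card_map, Finset.card_univ,
      Nat.cast_sub (Fintype.card_le_of_embedding e)]
  rw [hT]
  rcases hm.eq_or_lt with hm | hm
  · have : S = 0 := le_antisymm (hm ▸ hS₁) hS₀
    rw [← hm, this]
    simp only [zero_add, div_zero, zero_div, sub_zero]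
    rw [abs_of_nonneg (by positivity), div_le_one hN]
    linarith
  · have h₂ : R / N ≤ 1 - m / N := by
      rw [one_sub_div hN.ne']; gcongr
    have h₃ : S / m - S / N ≤ 1 - m / N := by
      have : S / m - S / N = S / m * (1 - m / N) := by field_simp
      rw [this]
      exact mul_le_of_le_one_left (sub_nonneg.2 ((div_le_one hN).2 hmN)) ((div_le_one hm).2 hS₁)
    have h₄ : 0 ≤ R / N := by positivity
    have h₅ : S / N ≤ S / m := by gcongr
    rw [add_div, abs_le]
    constructor <;> linarith

/-- Pairs of injections, as pairs of maps. -/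
def embeddingPair (k₁ k₂ n₁ n₂ : ℕ) :
    (Fin k₁ ↪ Fin n₁) × (Fin k₂ ↪ Fin n₂) ↪ (Fin k₁ → Fin n₁) × (Fin k₂ → Fin n₂) :=
  Function.Embedding.prodMap ⟨_, DFunLike.coe_injective⟩ ⟨_, DFunLike.coe_injective⟩

theorem card_embeddingPair (k₁ k₂ n₁ n₂ : ℕ) :
    (Fintype.card ((Fin k₁ ↪ Fin n₁) × (Fin k₂ ↪ Fin n₂)) : ℝ) /
      Fintype.card ((Fin k₁ → Fin n₁) × (Fin k₂ → Fin n₂)) = injProb k₁ n₁ * injProb k₂ n₂ := by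
  simp only [injProb, Nat.card_eq_fintype_card, Fintype.card_prod, Nat.cast_mul]
  rw [div_mul_div_comm]

theorem natCard_subtype_eq_sum {Ω : Type*} [Fintype Ω] (P : Ω → Prop) [DecidablePred P] :
    (Nat.card {x // P x} : ℝ) = ∑ x, if P x then (1 : ℝ) else 0 := by
  simp [Nat.card_eq_fintype_card, Fintype.card_subtype]

theorem abs_sampleMeasure_sub_tIndLab_le {k₁ k₂ n₁ n₂ : ℕ} [NeZero n₁] [NeZero n₂]
    (F : Lab (Fin k₁) (Fin k₂)) (G : Lab (Fin n₁) (Fin n₂)) :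
    |(sampleMeasure G : Measure LabInf).real {H | restr k₁ k₂ H = F} - tIndLab F G| ≤
      1 - injProb k₁ n₁ * injProb k₂ n₂ := by
  classical
  have h := abs_average_sub_average_le (embeddingPair k₁ k₂ n₁ n₂)
    (f := fun p => if (fun i j => G (p.1 i) (p.2 j)) ∈ ({F} : Set _) then (1 : ℝ) else 0)
    (fun p => by split_ifs <;> norm_num) (fun p => by split_ifs <;> norm_num)
  rw [card_embeddingPair] at h
  convert h using 3
  · refine (sampleMeasure_preimage_restr G {F}).trans ?_
    rw [natCard_subtype_eq_sum, Nat.card_eq_fintype_card]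
  · rw [tIndLab, natCard_subtype_eq_sum, Nat.card_eq_fintype_card]
    congr 1
    refine Finset.sum_congr rfl fun p _ => if_congr ?_ rfl rfl
    simp only [Set.mem_singleton_iff, funext_iff]
    exact forall₂_congr fun i j => eq_comm

/-! ### The projection to `BStarBar` and the extension of `tInd` -/

/-- The projection of the compactification that forgets the numbers of vertices. -/
def proj (Γ : BBar) : BStarBar :=
  ⟨Γ.1.1, map_mem_closure continuous_fst Γ.2 (by rintro _ ⟨G, rfl⟩; exact ⟨G, rfl⟩)⟩

theorem continuous_proj : Continuous proj :=
  (continuous_fst.comp continuous_subtype_val).subtype_mk _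

theorem abs_limitLaw_sub_tInd_le {k₁ k₂ : ℕ+} (F : Lab (Fin k₁) (Fin k₂)) (G : Unl) :
    |(limitLaw (proj (toBBar G)) : Measure LabInf).real {H | restr k₁ k₂ H = F} -
      tInd (unl F) G| ≤ 1 - injProb k₁ (v₁ G) * injProb k₂ (v₂ G) := by
  obtain ⟨n₁, n₂, G, rfl⟩ := exists_unl G
  have e : proj (toBBar (unl G)) = ⟨tau (unl G), subset_closure ⟨_, rfl⟩⟩ := rfl
  rw [e, limitLaw_tau]
  exact abs_sampleMeasure_sub_tIndLab_le F G

theorem v₁_pos (G : Unl) : 0 < v₁ G := G.1.1.pos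

theorem v₂_pos (G : Unl) : 0 < v₂ G := G.1.2.pos

theorem tendsto_atTop_of_tendsto_inv {ι : Type*} {L : Filter ι} {n : ι → ℕ} (hn : ∀ i, 0 < n i)
    (h : Tendsto (fun i => ((n i : ℝ))⁻¹) L (𝓝 0)) : Tendsto n L atTop := by
  have h' : Tendsto (fun i => ((n i : ℝ))⁻¹) L (𝓝[>] 0) :=
    tendsto_nhdsWithin_iff.2 ⟨h, Eventually.of_forall fun i => by
      have := hn i
      simp only [Set.mem_Ioi]; positivity⟩
  have h'' := tendsto_inv_nhdsGT_zero.comp h'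
  rw [← tendsto_natCast_atTop_iff (R := ℝ)]
  exact h''.congr fun i => inv_inv _

theorem tendsto_v₁ (Γ : BInf) : Tendsto v₁ (comap toBBar (𝓝 (Γ : BBar))) atTop := by
  refine tendsto_atTop_of_tendsto_inv v₁_pos ?_
  have h : Continuous fun Γ : BBar => (Γ.1.2.1 : ℝ) := by fun_prop
  have h' := (h.tendsto (Γ : BBar)).comp (tendsto_comap (f := toBBar))
  rwa [Γ.2.1] at h'

theorem tendsto_v₂ (Γ : BInf) : Tendsto v₂ (comap toBBar (𝓝 (Γ : BBar))) atTop := by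
  refine tendsto_atTop_of_tendsto_inv v₂_pos ?_
  have h : Continuous fun Γ : BBar => (Γ.1.2.2 : ℝ) := by fun_prop
  have h' := (h.tendsto (Γ : BBar)).comp (tendsto_comap (f := toBBar))
  rwa [Γ.2.2] at h'

theorem tendsto_one_sub_injProb {ι : Type*} {L : Filter ι} {n₁ n₂ : ι → ℕ} (k₁ k₂ : ℕ)
    (h₁ : Tendsto n₁ L atTop) (h₂ : Tendsto n₂ L atTop) :
    Tendsto (fun i => 1 - injProb k₁ (n₁ i) * injProb k₂ (n₂ i)) L (𝓝 0) := by
  have h := ((tendsto_injProb k₁).comp h₁).mul ((tendsto_injProb k₂).comp h₂)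
  simpa using (tendsto_const_nhds (x := (1 : ℝ))).sub h

theorem tendsto_tInd {k₁ k₂ : ℕ+} (F : Lab (Fin k₁) (Fin k₂)) (Γ : BInf) :
    Tendsto (tInd (unl F)) (comap toBBar (𝓝 (Γ : BBar)))
      (𝓝 ((limitLaw (proj Γ) : Measure LabInf).real {H | restr k₁ k₂ H = F})) := by
  have h : Continuous fun Γ : BBar =>
      (limitLaw (proj Γ) : Measure LabInf).real {H | restr k₁ k₂ H = F} :=
    (continuous_measureReal_of_isClopen (isClopen_restr_eq F)).comp
      (continuous_limitLaw.comp continuous_proj)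
  have h₁ := (h.tendsto (Γ : BBar)).comp (tendsto_comap (f := toBBar))
  have h₂ := squeeze_zero_norm (fun G => (Real.norm_eq_abs _).trans_le (abs_limitLaw_sub_tInd_le F G))
    (tendsto_one_sub_injProb k₁ k₂ (tendsto_v₁ Γ) (tendsto_v₂ Γ))
  simpa using h₁.sub h₂

instance (Γ : BBar) : (comap toBBar (𝓝 Γ)).NeBot := by
  refine comap_neBot_iff.2 fun s hs => ?_
  obtain ⟨u, hu, hus⟩ := mem_nhds_subtype _ _ _ |>.1 hs
  obtain ⟨_, hx, G, rfl⟩ := mem_closure_iff_nhds.1 Γ.2 u hu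
  exact ⟨G, hus hx⟩

theorem tIndBar_eq {k₁ k₂ : ℕ+} (F : Lab (Fin k₁) (Fin k₂)) (Γ : BInf) :
    tIndBar (unl F) Γ = (limitLaw (proj Γ) : Measure LabInf).real {H | restr k₁ k₂ H = F} :=
  (tendsto_tInd F Γ).limUnder_eq

theorem tendsto_tIndBar (F : Unl) (Γ : BInf) :
    Tendsto (tInd F) (comap toBBar (𝓝 (Γ : BBar))) (𝓝 (tIndBar F Γ)) := by
  obtain ⟨k₁, k₂, F, rfl⟩ := exists_unl F
  rw [tIndBar_eq]
  exact tendsto_tInd F Γ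


/-! ### Disjoint unions and the moment problem on `BStarBar` -/

/-- The disjoint union of two finite bipartite graphs. -/
def disjUnion {k₁ k₂ l₁ l₂ : ℕ} (F : Lab (Fin k₁) (Fin k₂)) (F' : Lab (Fin l₁) (Fin l₂)) :
    Lab (Fin (k₁ + l₁)) (Fin (k₂ + l₂)) := fun i j =>
  Fin.addCases (fun i => Fin.addCases (fun j => F i j) (fun _ => false) j)
    (fun i => Fin.addCases (fun _ => false) (fun j => F' i j) j) i

theorem tLab_disjUnion {k₁ k₂ l₁ l₂ n₁ n₂ : ℕ} (F : Lab (Fin k₁) (Fin k₂))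
    (F' : Lab (Fin l₁) (Fin l₂)) (G : Lab (Fin n₁) (Fin n₂)) :
    tLab (disjUnion F F') G = tLab F G * tLab F' G := by
  let e := (Equiv.prodProdProdComm (Fin k₁ → Fin n₁) (Fin k₂ → Fin n₂) (Fin l₁ → Fin n₁)
    (Fin l₂ → Fin n₂)).trans (Equiv.prodCongr (Fin.appendEquiv k₁ l₁) (Fin.appendEquiv k₂ l₂))
  unfold tLab
  rw [div_mul_div_comm, ← Nat.cast_mul, ← Nat.cast_mul, ← Nat.card_prod, ← Nat.card_prod]
  congr 2
  · refine (Nat.card_congr ((Equiv.subtypeProdEquivProd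
      (p := fun p : (Fin k₁ → Fin n₁) × (Fin k₂ → Fin n₂) =>
        ∀ i j, F i j = true → G (p.1 i) (p.2 j) = true)
      (q := fun p : (Fin l₁ → Fin n₁) × (Fin l₂ → Fin n₂) =>
        ∀ i j, F' i j = true → G (p.1 i) (p.2 j) = true)).symm.trans
      (Equiv.subtypeEquiv e ?_))).symm
    rintro ⟨⟨f, g⟩, ⟨f', g'⟩⟩
    simp [e, Fin.forall_fin_add, disjUnion]
  · exact (Nat.card_congr e).symm

theorem apply_disjUnion (x : BStarBar) {k₁ k₂ l₁ l₂ : ℕ+} (F : Lab (Fin k₁) (Fin k₂))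
    (F' : Lab (Fin l₁) (Fin l₂)) :
    (x.1 (unl (n₁ := k₁ + l₁) (n₂ := k₂ + l₂) (disjUnion F F')) : ℝ) =
      x.1 (unl F) * x.1 (unl F') := by
  have h : BStarBar ⊆ {x : Unl → unitInterval |
      (x (unl (n₁ := k₁ + l₁) (n₂ := k₂ + l₂) (disjUnion F F')) : ℝ) =
        x (unl F) * x (unl F')} := by
    refine closure_minimal ?_ (isClosed_eq (by fun_prop) (by fun_prop))
    rintro _ ⟨G, rfl⟩
    obtain ⟨n₁, n₂, G, rfl⟩ := exists_unl G
    exact tLab_disjUnion F F' G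
  exact h x.2

theorem apply_edgeless (x : BStarBar) :
    (x.1 (unl (n₁ := 1) (n₂ := 1) fun _ _ => false) : ℝ) = 1 := by
  have h : BStarBar ⊆ {x : Unl → unitInterval |
      (x (unl (n₁ := 1) (n₂ := 1) fun _ _ => false) : ℝ) = 1} := by
    refine closure_minimal ?_ (isClosed_eq (by fun_prop) (by fun_prop))
    rintro _ ⟨G, rfl⟩
    obtain ⟨n₁, n₂, G, rfl⟩ := exists_unl G
    change tLab _ G = 1
    unfold tLab
    rw [Nat.card_congr (Equiv.subtypeUnivEquiv (by simp))]
    exact div_self (by simp)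
  exact h x.2

instance : CompactSpace BStarBar := isCompact_iff_compactSpace.1 isClosed_closure.isCompact

instance : CompactSpace BBar := isCompact_iff_compactSpace.1 isClosed_closure.isCompact

/-- The coordinate `t(F,·)` as a continuous function on `BStarBar`. -/
def coord (F : Unl) : BoundedContinuousFunction BStarBar ℝ :=
  BoundedContinuousFunction.mkOfCompact
    ⟨fun x => (x.1 F : ℝ),
      continuous_subtype_val.comp ((continuous_apply F).comp continuous_subtype_val)⟩

theorem closure_range_coord : (Submonoid.closure (Set.range coord) : Set _) = Set.range coord := by
  let M : Submonoid (BoundedContinuousFunction BStarBar ℝ) :=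
    { carrier := Set.range coord
      one_mem' := ⟨_, BoundedContinuousFunction.ext apply_edgeless⟩
      mul_mem' := by
        rintro _ _ ⟨F, rfl⟩ ⟨F', rfl⟩
        obtain ⟨k₁, k₂, F, rfl⟩ := exists_unl F
        obtain ⟨l₁, l₂, F', rfl⟩ := exists_unl F'
        exact ⟨_, BoundedContinuousFunction.ext fun x => apply_disjUnion x F F'⟩ }
  exact congrArg _ (Submonoid.closure_eq M)

/-- The algebra spanned by the functions `t(F,·)`. -/
def coordAlgebra : StarSubalgebra ℝ (BoundedContinuousFunction BStarBar ℝ) :=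
  { Algebra.adjoin ℝ (Set.range coord) with
    star_mem' := fun {a} ha => by
      have : star a = a := BoundedContinuousFunction.ext fun x => by simp
      rwa [this] }

theorem mem_coordAlgebra {g : BoundedContinuousFunction BStarBar ℝ} :
    g ∈ coordAlgebra ↔ g ∈ Submodule.span ℝ (Set.range coord) := by
  rw [← Algebra.adjoin_eq_span_of_subset ℝ
    (closure_range_coord.subset.trans Submodule.subset_span)]
  rfl

theorem ext_of_integral_coord {μ μ' : ProbabilityMeasure BStarBar}
    (h : ∀ F : Unl, ∫ x, (x.1 F : ℝ) ∂(μ : Measure BStarBar) =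
      ∫ x, (x.1 F : ℝ) ∂(μ' : Measure BStarBar)) : μ = μ' := by
  apply Subtype.ext
  refine ext_of_forall_mem_subalgebra_integral_eq_of_polish (𝕜 := ℝ)
    (P := (μ : Measure BStarBar)) (P' := (μ' : Measure BStarBar)) (A := coordAlgebra) ?_ ?_
  · intro x y hxy
    have : ∃ F, x.1 F ≠ y.1 F := by
      by_contra! hc
      exact hxy (Subtype.ext (funext hc))
    obtain ⟨F, hF⟩ := this
    refine ⟨_, ⟨_, ⟨coord F, mem_coordAlgebra.2 (Submodule.subset_span ⟨F, rfl⟩), rfl⟩, rfl⟩, ?_⟩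
    exact fun hc => hF (Subtype.ext hc)
  · intro g hg
    rw [mem_coordAlgebra] at hg
    induction hg using Submodule.span_induction with
    | mem g hg => obtain ⟨F, rfl⟩ := hg; exact h F
    | zero => simp
    | add f g _ _ hf hg =>
      simp only [BoundedContinuousFunction.coe_add, Pi.add_apply]
      rw [integral_add (f.integrable _) (g.integrable _),
        integral_add (f.integrable _) (g.integrable _), hf, hg]
    | smul a f _ hf =>
      simp only [BoundedContinuousFunction.coe_smul, integral_smul]
      rw [hf]

theorem injective_mixture : Function.Injective mixture := by
  intro μ μ' h
  refine ext_of_integral_coord fun F => ?_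
  obtain ⟨k₁, k₂, F, rfl⟩ := exists_unl F
  rw [← mixture_contains, h, mixture_contains]

/-! ### Blow-ups and the homeomorphism between `BInf` and `BStarBar` -/

/-- The blow-up of `G`, each vertex being replaced by `m` copies. -/
def blowup {n₁ n₂ : ℕ} (m : ℕ) (G : Lab (Fin n₁) (Fin n₂)) : Lab (Fin (n₁ * m)) (Fin (n₂ * m)) :=
  fun i j => G i.divNat j.divNat

theorem tLab_blowup {k₁ k₂ n₁ n₂ m : ℕ} (hm : m ≠ 0) (F : Lab (Fin k₁) (Fin k₂))
    (G : Lab (Fin n₁) (Fin n₂)) : tLab F (blowup m G) = tLab F G := by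
  let e (k n : ℕ) : (Fin k → Fin n) × (Fin k → Fin m) ≃ (Fin k → Fin (n * m)) :=
    (Equiv.arrowProdEquivProdArrow (Fin k) (fun _ => Fin n) (fun _ => Fin m)).symm.trans
      (Equiv.arrowCongr (Equiv.refl _) finProdFinEquiv)
  let e' := (Equiv.prodProdProdComm (Fin k₁ → Fin n₁) (Fin k₂ → Fin n₂) (Fin k₁ → Fin m)
    (Fin k₂ → Fin m)).trans (Equiv.prodCongr (e k₁ n₁) (e k₂ n₂))
  have he : ∀ k n (f : Fin k → Fin n) (g : Fin k → Fin m) i, (e k n (f, g) i).divNat = f i := by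
    intro k n f g i
    exact congrArg Prod.fst (finProdFinEquiv.symm_apply_apply (f i, g i))
  have : NeZero m := ⟨hm⟩
  have h₁ : Nat.card {p : (Fin k₁ → Fin (n₁ * m)) × (Fin k₂ → Fin (n₂ * m)) //
      ∀ i j, F i j = true → blowup m G (p.1 i) (p.2 j) = true} =
      Nat.card {p : (Fin k₁ → Fin n₁) × (Fin k₂ → Fin n₂) //
        ∀ i j, F i j = true → G (p.1 i) (p.2 j) = true} *
      Nat.card ((Fin k₁ → Fin m) × (Fin k₂ → Fin m)) := by
    rw [← Nat.card_prod]
    refine (Nat.card_congr ((Equiv.prodSubtypeFstEquivSubtypeProd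
      (p := fun p : (Fin k₁ → Fin n₁) × (Fin k₂ → Fin n₂) =>
        ∀ i j, F i j = true → G (p.1 i) (p.2 j) = true)).symm.trans
      (Equiv.subtypeEquiv e' ?_))).symm
    rintro ⟨⟨f, g⟩, ⟨f', g'⟩⟩
    change _ ↔ ∀ i j, F i j = true →
      G (e k₁ n₁ (f, f') i).divNat (e k₂ n₂ (g, g') j).divNat = true
    simp only [he]
  have h₂ : Nat.card ((Fin k₁ → Fin (n₁ * m)) × (Fin k₂ → Fin (n₂ * m))) =
      Nat.card ((Fin k₁ → Fin n₁) × (Fin k₂ → Fin n₂)) *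
        Nat.card ((Fin k₁ → Fin m) × (Fin k₂ → Fin m)) := by
    rw [← Nat.card_prod, Nat.card_congr e']
  rw [tLab, tLab, h₁, h₂, Nat.cast_mul, Nat.cast_mul, mul_div_mul_right]
  exact_mod_cast Nat.card_pos.ne'

theorem tau_blowup {n₁ n₂ : ℕ+} (m : ℕ+) (G : Lab (Fin n₁) (Fin n₂)) :
    tau (unl (n₁ := n₁ * m) (n₂ := n₂ * m) (blowup m G)) = tau (unl G) := by
  funext F
  obtain ⟨k₁, k₂, F, rfl⟩ := exists_unl F
  exact Subtype.ext (tLab_blowup m.pos.ne' F G)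

theorem tendsto_inv_mul_succPNat (n : ℕ+) :
    Tendsto (fun m : ℕ => (⟨(((n * m.succPNat : ℕ+) : ℕ) : ℝ)⁻¹, inv_natCast_mem _⟩ : unitInterval))
      atTop (𝓝 0) := by
  rw [tendsto_subtype_rng]
  have h : Tendsto (fun m : ℕ => ((m : ℝ) + 1)⁻¹ * (n : ℝ)⁻¹) atTop (𝓝 (0 * (n : ℝ)⁻¹)) := by
    simpa using (tendsto_one_div_add_atTop_nhds_zero_nat (𝕜 := ℝ)).mul_const ((n : ℝ)⁻¹)
  rw [zero_mul] at h
  refine h.congr fun m => ?_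
  simp [mul_comm]

theorem mem_BBar_of_mem_BStarBar {x : Unl → unitInterval} (hx : x ∈ BStarBar) :
    (x, 0, 0) ∈ BBar := by
  have h : Set.MapsTo (fun x : Unl → unitInterval => (x, (0 : unitInterval), (0 : unitInterval)))
      (Set.range tau) BBar := by
    rintro _ ⟨G, rfl⟩
    obtain ⟨n₁, n₂, G, rfl⟩ := exists_unl G
    refine mem_closure_of_tendsto (b := atTop) (f := fun m : ℕ =>
      tauPlus (unl (n₁ := n₁ * m.succPNat) (n₂ := n₂ * m.succPNat) (blowup m.succPNat G)))
      ?_ (Eventually.of_forall fun m => ⟨_, rfl⟩)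
    simp only [tauPlus, tau_blowup]
    exact tendsto_const_nhds.prodMk_nhds
      ((tendsto_inv_mul_succPNat n₁).prodMk_nhds (tendsto_inv_mul_succPNat n₂))
  exact h.closure_left (by fun_prop) isClosed_closure hx

/-- The section of `proj` with values in the graph limits. -/
def lift (x : BStarBar) : BBar := ⟨(x.1, 0, 0), mem_BBar_of_mem_BStarBar x.2⟩

theorem continuous_lift : Continuous lift := by
  unfold lift; fun_prop

theorem lift_proj (Γ : BInf) : lift (proj Γ) = Γ :=
  Subtype.ext (Prod.ext rfl (Prod.ext Γ.2.1.symm Γ.2.2.symm))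

/-- The graph limits are identified with `BStarBar` by forgetting the numbers of vertices. -/
def limitHomeo : BInf ≃ₜ BStarBar where
  toFun Γ := proj Γ
  invFun x := ⟨lift x, rfl, rfl⟩
  left_inv Γ := Subtype.ext (lift_proj Γ)
  right_inv _ := rfl
  continuous_toFun := continuous_proj.comp continuous_subtype_val
  continuous_invFun := continuous_lift.subtype_mk _


/-! ### Finite restrictions of exchangeable graphs -/

theorem exists_finite_perm_extending {k n : ℕ} (p : Fin k ↪ Fin n) :
    ∃ σ : Equiv.Perm ℕ, {i | σ i ≠ i}.Finite ∧ ∀ i : Fin k, σ i = p i := by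
  have hkn : k ≤ n := by simpa using Fintype.card_le_of_embedding p
  obtain ⟨σ, hσ⟩ := Equiv.Perm.exists_extending_pair (Fin.castLE hkn) p
    (Fin.castLE_injective hkn) p.injective
  refine ⟨σ.viaFintypeEmbedding Fin.valEmbedding, ?_, fun i => ?_⟩
  · refine (Set.finite_lt_nat n).subset fun i hi => ?_
    by_contra hc
    refine hi (Equiv.Perm.viaFintypeEmbedding_apply_notMem_range _ _ ?_)
    rintro ⟨j, rfl⟩
    exact hc j.2
  · have h := Equiv.Perm.viaFintypeEmbedding_apply_image σ Fin.valEmbedding (Fin.castLE hkn i)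
    rw [hσ] at h
    exact h

theorem measurableSet_containsImage {k₁ k₂ n₁ n₂ : ℕ} (F : Lab (Fin k₁) (Fin k₂))
    (p : (Fin k₁ → Fin n₁) × (Fin k₂ → Fin n₂)) :
    MeasurableSet {H : LabInf | ∀ i j, F i j = true → H (p.1 i) (p.2 j) = true} :=
  (isClopen_restr_preimage (k₁ := n₁) (k₂ := n₂)
    {G | ∀ i j, F i j = true → G (p.1 i) (p.2 j) = true}).isOpen.measurableSet

theorem Exchangeable.measureReal_containsImage {ν : ProbabilityMeasure LabInf}
    (hν : Exchangeable ν) {k₁ k₂ n₁ n₂ : ℕ} (F : Lab (Fin k₁) (Fin k₂))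
    (p : (Fin k₁ ↪ Fin n₁) × (Fin k₂ ↪ Fin n₂)) :
    (ν : Measure LabInf).real {H | ∀ i j, F i j = true → H (p.1 i) (p.2 j) = true} =
      (ν : Measure LabInf).real {H | Contains H F} := by
  obtain ⟨σ, hσ, hσp⟩ := exists_finite_perm_extending p.1
  obtain ⟨τ, hτ, hτp⟩ := exists_finite_perm_extending p.2
  conv_rhs => rw [← hν σ τ hσ hτ]
  rw [map_measureReal_apply (measurable_permute σ τ) (isClopen_contains F).isOpen.measurableSet]
  congr 1
  ext H
  simp [Contains, permute, hσp, hτp]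

theorem integral_tLab_restr (ν : ProbabilityMeasure LabInf) {k₁ k₂ : ℕ} (n₁ n₂ : ℕ)
    (F : Lab (Fin k₁) (Fin k₂)) :
    ∫ H, tLab F (restr n₁ n₂ H) ∂(ν : Measure LabInf) =
      (∑ p : (Fin k₁ → Fin n₁) × (Fin k₂ → Fin n₂),
        (ν : Measure LabInf).real {H | ∀ i j, F i j = true → H (p.1 i) (p.2 j) = true}) /
      Fintype.card ((Fin k₁ → Fin n₁) × (Fin k₂ → Fin n₂)) := by
  classical
  have e : ∀ H : LabInf, tLab F (restr n₁ n₂ H) =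
      (∑ p : (Fin k₁ → Fin n₁) × (Fin k₂ → Fin n₂),
        {H : LabInf | ∀ i j, F i j = true → H (p.1 i) (p.2 j) = true}.indicator 1 H) /
      Fintype.card ((Fin k₁ → Fin n₁) × (Fin k₂ → Fin n₂)) := by
    intro H
    unfold tLab
    rw [natCard_subtype_eq_sum, Nat.card_eq_fintype_card]
    congr 1
    refine Finset.sum_congr rfl fun p _ => ?_
    rw [Set.indicator_apply]
    rfl
  simp only [e]
  rw [integral_div, integral_finsetSum]
  · congr 1
    exact Finset.sum_congr rfl fun p _ => integral_indicator_one (measurableSet_containsImage F p)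
  · exact fun p _ => (integrable_const (1 : ℝ)).indicator (measurableSet_containsImage F p)

theorem Exchangeable.abs_integral_tLab_restr_sub_le {ν : ProbabilityMeasure LabInf}
    (hν : Exchangeable ν) {k₁ k₂ n₁ n₂ : ℕ} [NeZero n₁] [NeZero n₂] (h₁ : k₁ ≤ n₁) (h₂ : k₂ ≤ n₂)
    (F : Lab (Fin k₁) (Fin k₂)) :
    |∫ H, tLab F (restr n₁ n₂ H) ∂(ν : Measure LabInf) -
      (ν : Measure LabInf).real {H | Contains H F}| ≤ 1 - injProb k₁ n₁ * injProb k₂ n₂ := by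
  have h := abs_average_sub_average_le (embeddingPair k₁ k₂ n₁ n₂)
    (f := fun p => (ν : Measure LabInf).real
      {H | ∀ i j, F i j = true → H (p.1 i) (p.2 j) = true})
    (fun p => measureReal_nonneg) (fun p => measureReal_le_one)
  have e := Finset.sum_congr (s₁ := Finset.univ) rfl fun p _ =>
    hν.measureReal_containsImage (n₁ := n₁) (n₂ := n₂) F p
  rw [card_embeddingPair, ← integral_tLab_restr] at h
  erw [e] at h
  rw [Finset.sum_const, Finset.card_univ, nsmul_eq_mul, mul_div_cancel_left₀] at h
  · exact h
  · have : Nonempty ((Fin k₁ ↪ Fin n₁) × (Fin k₂ ↪ Fin n₂)) :=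
      ⟨Fin.castLEEmb h₁, Fin.castLEEmb h₂⟩
    exact_mod_cast Fintype.card_ne_zero

/-- The law of the restriction to `[n₁] × [n₂]`, as a law on the compactification. -/
def restrLaw (ν : ProbabilityMeasure LabInf) (n : ℕ+ × ℕ+) : ProbabilityMeasure BBar :=
  ν.map (measurable_sub n).aemeasurable

theorem integral_restrLaw (ν : ProbabilityMeasure LabInf) (n : ℕ+ × ℕ+) {f : BBar → ℝ}
    (hf : Continuous f) : ∫ Γ, f Γ ∂(restrLaw ν n : Measure BBar) =
      ∫ H, f (sub n H) ∂(ν : Measure LabInf) :=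
  integral_map (measurable_sub n).aemeasurable hf.aestronglyMeasurable

theorem continuous_tBar (F : Unl) : Continuous (tBar F) :=
  continuous_subtype_val.comp
    ((continuous_apply F).comp (continuous_fst.comp continuous_subtype_val))

theorem tendsto_pnat_fst : Tendsto (fun n : ℕ+ × ℕ+ => (n.1 : ℕ)) atTop atTop := by
  rw [← prod_atTop_atTop_eq]
  exact tendsto_PNat_val_atTop_atTop.comp tendsto_fst

theorem tendsto_pnat_snd : Tendsto (fun n : ℕ+ × ℕ+ => (n.2 : ℕ)) atTop atTop := by
  rw [← prod_atTop_atTop_eq]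
  exact tendsto_PNat_val_atTop_atTop.comp tendsto_snd

theorem Exchangeable.tendsto_integral_tBar {ν : ProbabilityMeasure LabInf} (hν : Exchangeable ν)
    {k₁ k₂ : ℕ+} (F : Lab (Fin k₁) (Fin k₂)) :
    Tendsto (fun n => ∫ Γ, tBar (unl F) Γ ∂(restrLaw ν n : Measure BBar)) atTop
      (𝓝 ((ν : Measure LabInf).real {H | Contains H F})) := by
  rw [tendsto_iff_norm_sub_tendsto_zero]
  refine squeeze_zero' (Eventually.of_forall fun n => norm_nonneg _) ?_
    (tendsto_one_sub_injProb k₁ k₂ tendsto_pnat_fst tendsto_pnat_snd)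
  filter_upwards [tendsto_pnat_fst.eventually_ge_atTop (k₁ : ℕ),
    tendsto_pnat_snd.eventually_ge_atTop (k₂ : ℕ)] with n h₁ h₂
  rw [integral_restrLaw ν n (continuous_tBar _), Real.norm_eq_abs]
  exact hν.abs_integral_tLab_restr_sub_le h₁ h₂ F

theorem continuous_integral_of_continuous {X : Type*} [TopologicalSpace X] [CompactSpace X]
    [MeasurableSpace X] [OpensMeasurableSpace X] {f : X → ℝ} (hf : Continuous f) :
    Continuous fun θ : ProbabilityMeasure X => ∫ x, f x ∂(θ : Measure X) :=
  ProbabilityMeasure.continuous_integral_boundedContinuousFunction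
    (BoundedContinuousFunction.mkOfCompact ⟨f, hf⟩)

theorem tendsto_integral_restrLaw_fst (ν : ProbabilityMeasure LabInf) :
    Tendsto (fun n => ∫ Γ, (Γ.1.2.1 : ℝ) ∂(restrLaw ν n : Measure BBar)) atTop (𝓝 0) := by
  refine (tendsto_inv_atTop_nhds_zero_nat.comp tendsto_pnat_fst).congr fun n => ?_
  rw [integral_restrLaw ν n (by fun_prop)]
  simp [sub, toBBar, tauPlus, unl, v₁]

theorem tendsto_integral_restrLaw_snd (ν : ProbabilityMeasure LabInf) :
    Tendsto (fun n => ∫ Γ, (Γ.1.2.2 : ℝ) ∂(restrLaw ν n : Measure BBar)) atTop (𝓝 0) := by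
  refine (tendsto_inv_atTop_nhds_zero_nat.comp tendsto_pnat_snd).congr fun n => ?_
  rw [integral_restrLaw ν n (by fun_prop)]
  simp [sub, toBBar, tauPlus, unl, v₂]

theorem ae_eq_zero_of_integral_eq_zero {X : Type*} [TopologicalSpace X] [CompactSpace X]
    [MeasurableSpace X] [BorelSpace X] {θ : ProbabilityMeasure X} {f : X → unitInterval}
    (hf : Continuous f) (h : ∫ x, (f x : ℝ) ∂(θ : Measure X) = 0) :
    ∀ᵐ x ∂(θ : Measure X), f x = 0 := by
  have hc : Continuous fun x => (f x : ℝ) := continuous_subtype_val.comp hf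
  rw [integral_eq_zero_iff_of_nonneg (fun x => (f x).2.1)
    ((BoundedContinuousFunction.mkOfCompact ⟨_, hc⟩).integrable _)] at h
  filter_upwards [h] with x hx
  exact Subtype.ext hx

/-- The image under `proj` of a law on the compactification. -/
def projLaw (θ : ProbabilityMeasure BBar) : ProbabilityMeasure BStarBar :=
  θ.map continuous_proj.measurable.aemeasurable

/-- The image under `lift` of a law on `BStarBar`. -/
def liftLaw (μ : ProbabilityMeasure BStarBar) : ProbabilityMeasure BBar :=
  μ.map continuous_lift.measurable.aemeasurable

theorem Exchangeable.of_mapClusterPt {ν : ProbabilityMeasure LabInf} (hν : Exchangeable ν)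
    {θ : ProbabilityMeasure BBar} (hθ : MapClusterPt θ atTop (restrLaw ν)) :
    mixture (projLaw θ) = ν ∧ liftLaw (projLaw θ) = θ := by
  obtain ⟨U, hU, hθ⟩ := mapClusterPt_iff_ultrafilter.1 hθ
  have key : ∀ (f : BBar → ℝ) (a : ℝ), Continuous f →
      Tendsto (fun n => ∫ Γ, f Γ ∂(restrLaw ν n : Measure BBar)) atTop (𝓝 a) →
      ∫ Γ, f Γ ∂(θ : Measure BBar) = a := fun f a hf h =>
    tendsto_nhds_unique (((continuous_integral_of_continuous hf).tendsto θ).comp hθ)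
      (h.mono_left hU)
  constructor
  · apply Subtype.ext
    refine ext_of_contains (ν := (mixture (projLaw θ) : Measure LabInf))
      (ν' := (ν : Measure LabInf)) fun k₁ k₂ F => ?_
    rw [mixture_contains, ← key _ _ (continuous_tBar (unl F)) (hν.tendsto_integral_tBar F)]
    exact integral_map continuous_proj.measurable.aemeasurable
      (coord (unl F)).continuous.aestronglyMeasurable
  · have h₁ := ae_eq_zero_of_integral_eq_zero (θ := θ) (f := fun Γ => Γ.1.2.1) (by fun_prop)
      (key _ _ (by fun_prop) (tendsto_integral_restrLaw_fst ν))
    have h₂ := ae_eq_zero_of_integral_eq_zero (θ := θ) (f := fun Γ => Γ.1.2.2) (by fun_prop)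
      (key _ _ (by fun_prop) (tendsto_integral_restrLaw_snd ν))
    apply Subtype.ext
    change ((θ : Measure BBar).map proj).map lift = (θ : Measure BBar)
    rw [Measure.map_map continuous_lift.measurable continuous_proj.measurable]
    conv_rhs => rw [← Measure.map_id (μ := (θ : Measure BBar))]
    refine Measure.map_congr ?_
    filter_upwards [h₁, h₂] with Γ e₁ e₂
    exact lift_proj ⟨Γ, e₁, e₂⟩

/-- The correspondence between laws on `BStarBar` and exchangeable laws. -/
def starCorrespondence :
    ProbabilityMeasure BStarBar ≃ {ν : ProbabilityMeasure LabInf // Exchangeable ν} :=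
  Equiv.ofBijective (fun μ => ⟨mixture μ, exchangeable_mixture μ⟩)
    ⟨fun _ _ h => injective_mixture (congrArg Subtype.val h), fun ν => by
      obtain ⟨θ, hθ⟩ := exists_clusterPt_of_compactSpace (map (restrLaw ν.1) atTop)
      exact ⟨projLaw θ, Subtype.ext (ν.2.of_mapClusterPt hθ).1⟩⟩

theorem tendsto_restrLaw_mixture (μ : ProbabilityMeasure BStarBar) :
    Tendsto (restrLaw (mixture μ)) atTop (𝓝 (liftLaw μ)) := by
  refine tendsto_nhds_of_unique_mapClusterPt fun θ hθ => ?_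
  obtain ⟨h₁, h₂⟩ := (exchangeable_mixture μ).of_mapClusterPt hθ
  rw [← h₂, injective_mixture h₁]

/-- Laws on the graph limits are the same as laws on `BStarBar`. -/
def lawEquiv : ProbabilityMeasure BInf ≃ ProbabilityMeasure BStarBar where
  toFun μ := μ.map limitHomeo.measurable.aemeasurable
  invFun μ := μ.map limitHomeo.symm.measurable.aemeasurable
  left_inv μ := by
    apply Subtype.ext
    change ((μ : Measure BInf).map limitHomeo).map limitHomeo.symm = (μ : Measure BInf)
    rw [Measure.map_map limitHomeo.symm.measurable limitHomeo.measurable,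
      limitHomeo.symm_comp_self, Measure.map_id]
  right_inv μ := by
    apply Subtype.ext
    change ((μ : Measure BStarBar).map limitHomeo.symm).map limitHomeo = (μ : Measure BStarBar)
    rw [Measure.map_map limitHomeo.measurable limitHomeo.symm.measurable,
      limitHomeo.self_comp_symm, Measure.map_id]

theorem integral_lawEquiv (μ : ProbabilityMeasure BInf) {f : BStarBar → ℝ} :
    ∫ x, f x ∂(lawEquiv μ : Measure BStarBar) = ∫ Γ, f (proj Γ) ∂(μ : Measure BInf) :=
  limitHomeo.measurableEmbedding.integral_map f

theorem liftLaw_lawEquiv (μ : ProbabilityMeasure BInf) :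
    liftLaw (lawEquiv μ) = μ.map measurable_subtype_coe.aemeasurable := by
  apply Subtype.ext
  change ((μ : Measure BInf).map limitHomeo).map lift = (μ : Measure BInf).map Subtype.val
  rw [Measure.map_map continuous_lift.measurable limitHomeo.measurable]
  congr 1
  exact funext lift_proj

theorem mixture_eq_iff_restr (μ : ProbabilityMeasure BStarBar) (ν : ProbabilityMeasure LabInf) :
    mixture μ = ν ↔ ∀ (k₁ k₂ : ℕ+) (F : Lab (Fin k₁) (Fin k₂)),
      ∫ x, (limitLaw x : Measure LabInf).real {H | restr k₁ k₂ H = F} ∂(μ : Measure BStarBar) =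
        (ν : Measure LabInf).real {H | restr k₁ k₂ H = F} := by
  have e := fun (k₁ k₂ : ℕ+) (F : Lab (Fin k₁) (Fin k₂)) =>
    mixture_real μ (isClopen_restr_eq F).isOpen.measurableSet
  refine ⟨fun h k₁ k₂ F => by rw [← e, h], fun h => Subtype.ext ?_⟩
  exact ext_of_restr (ν := (mixture μ : Measure LabInf)) (ν' := (ν : Measure LabInf))
    fun k₁ k₂ F => (e k₁ k₂ F).trans (h k₁ k₂ F)

theorem mixture_eq_iff_contains (μ : ProbabilityMeasure BStarBar) (ν : ProbabilityMeasure LabInf) :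
    mixture μ = ν ↔ ∀ (k₁ k₂ : ℕ+) (F : Lab (Fin k₁) (Fin k₂)),
      ∫ x, ((x : Unl → unitInterval) (unl F) : ℝ) ∂(μ : Measure BStarBar) =
        (ν : Measure LabInf).real {H | Contains H F} := by
  refine ⟨fun h k₁ k₂ F => by rw [← mixture_contains, h], fun h => Subtype.ext ?_⟩
  exact ext_of_contains (ν := (mixture μ : Measure LabInf)) (ν' := (ν : Measure LabInf))
    fun k₁ k₂ F => (mixture_contains μ F).trans (h k₁ k₂ F)

end BipLimit

end

theorem theorem8p5 :
    -- the continuous extension of `t_ind(F,·)` to the graph limits makes sense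
    (∀ (F : BipLimit.Unl) (Γ : BipLimit.BInf),
      Tendsto (BipLimit.tInd F) (comap BipLimit.toBBar (𝓝 (Γ : BipLimit.BBar)))
        (𝓝 (BipLimit.tIndBar F Γ))) ∧
    ∃ (Φ : ProbabilityMeasure BipLimit.BInf ≃
          {ν : ProbabilityMeasure BipLimit.LabInf // BipLimit.Exchangeable ν})
      (π : BipLimit.BInf ≃ₜ BipLimit.BStarBar)
      (Ψ : ProbabilityMeasure BipLimit.BStarBar ≃
          {ν : ProbabilityMeasure BipLimit.LabInf // BipLimit.Exchangeable ν}),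
      -- the correspondence `Φ` for `𝓑_{∞,∞}`, given by `t_ind` or, equivalently, by `t`
      (∀ μ ν, Φ μ = ν ↔
        ∀ (k₁ k₂ : ℕ+) (F : BipLimit.Lab (Fin k₁) (Fin k₂)),
          ∫ Γ, BipLimit.tIndBar (BipLimit.unl F) Γ ∂(μ : Measure BipLimit.BInf) =
            (ν.1 : Measure BipLimit.LabInf).real {H | BipLimit.restr k₁ k₂ H = F}) ∧
      (∀ μ ν, Φ μ = ν ↔
        ∀ (k₁ k₂ : ℕ+) (F : BipLimit.Lab (Fin k₁) (Fin k₂)),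
          ∫ Γ, BipLimit.tBar (BipLimit.unl F) Γ ∂(μ : Measure BipLimit.BInf) =
            (ν.1 : Measure BipLimit.LabInf).real {H | BipLimit.Contains H F}) ∧
      -- convergence in distribution of the finite restrictions
      (∀ μ : ProbabilityMeasure BipLimit.BInf,
        Tendsto
          (fun n : ℕ+ × ℕ+ => (Φ μ).1.map (BipLimit.measurable_sub n).aemeasurable)
          atTop
          (𝓝 (μ.map measurable_subtype_coe.aemeasurable : ProbabilityMeasure BipLimit.BBar))) ∧
      -- `𝓑_{∞,∞}` is identified with the closure of `𝓑*` by forgetting `1/v₁` and `1/v₂`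
      (∀ Γ : BipLimit.BInf, (π Γ : BipLimit.Unl → unitInterval) = Γ.1.1.1) ∧
      -- the same correspondence for the closure of `𝓑*`
      (∀ μ : ProbabilityMeasure BipLimit.BInf,
        Ψ (μ.map π.measurable.aemeasurable) = Φ μ) ∧
      (∀ μ ν, Ψ μ = ν ↔
        ∀ (k₁ k₂ : ℕ+) (F : BipLimit.Lab (Fin k₁) (Fin k₂)),
          ∫ x, BipLimit.tIndBar (BipLimit.unl F) (π.symm x)
              ∂(μ : Measure BipLimit.BStarBar) =
            (ν.1 : Measure BipLimit.LabInf).real {H | BipLimit.restr k₁ k₂ H = F}) ∧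
      (∀ μ ν, Ψ μ = ν ↔
        ∀ (k₁ k₂ : ℕ+) (F : BipLimit.Lab (Fin k₁) (Fin k₂)),
          ∫ x, ((x : BipLimit.Unl → unitInterval) (BipLimit.unl F) : ℝ)
              ∂(μ : Measure BipLimit.BStarBar) =
            (ν.1 : Measure BipLimit.LabInf).real {H | BipLimit.Contains H F}) := by

  open BipLimit in
  refine ⟨tendsto_tIndBar, lawEquiv.trans starCorrespondence, limitHomeo, starCorrespondence,
    fun μ ν => ?_, fun μ ν => ?_, fun μ => ?_, fun _ => rfl, fun _ => rfl,
    fun μ ν => ?_, fun μ ν => ?_⟩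
  · simp only [tIndBar_eq]
    refine Subtype.ext_iff.trans ((mixture_eq_iff_restr (lawEquiv μ) ν.1).trans ?_)
    simp only [integral_lawEquiv]
  · refine Subtype.ext_iff.trans ((mixture_eq_iff_contains (lawEquiv μ) ν.1).trans ?_)
    simp only [integral_lawEquiv]
    rfl
  · rw [← liftLaw_lawEquiv]
    exact tendsto_restrLaw_mixture (lawEquiv μ)
  · simp only [tIndBar_eq]
    exact Subtype.ext_iff.trans (mixture_eq_iff_restr μ ν.1)
  · exact Subtype.ext_iff.trans (mixture_eq_iff_contains μ ν.1)
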